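/- Let ${n\brace m}_{\ge 2}$ denote the 2-associated Stirling subset numbers, defined by $(e^z-1-z)^m = m!\sum_{n\ge 0} {n\brace m}_{\ge 2}\, z^n/n!$. For real $x>0$ let $W(x)$ (the Lambert $W$ function) be the unique positive solution $y$ of $y e^y = x$. For real $x\ge 2$ put $L_1=\ln x$, $L_2=\ln\ln x$, $\sigma = 1/L_1$, $\tau = L_2/L_1$ and $\zeta = 1/(1+\sigma)$. Then for every real $x\ge 2$ the series on the right-hand side below converges absolutely (as a series over $m$), and $$W(x) = L_1 - L_2 + \sum_{m\ge 1} \frac{\tau^m}{m!} \sum_{p=0}^{m-1} (-1)^{p+m-1}\, \zeta^{p+m} {p+m-1\brace p}_{\ge 2}.$$ -/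

import Mathlib

open scoped Nat

/-- The 2-associated Stirling subset number `{n brace m}_{≥2}`, as a real number. It is defined by
its generating function `(e^z - 1 - z)^m = m! ∑ₙ {n brace m}_{≥2} z^n / n!`. -/
noncomputable def assocStirlingSubset (n m : ℕ) : ℝ :=
  (n ! : ℝ) / (m ! : ℝ) *
    PowerSeries.coeff n ((PowerSeries.exp ℝ - 1 - (PowerSeries.X : PowerSeries ℝ)) ^ m)

/-- The defining generating function identity, as an identity of formal power series. -/
theorem assocStirlingSubset_genFun (m : ℕ) :
    (PowerSeries.exp ℝ - 1 - (PowerSeries.X : PowerSeries ℝ)) ^ m =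
      (m ! : ℝ) • PowerSeries.mk (fun n => assocStirlingSubset n m / (n ! : ℝ)) := by
  ext n
  have hm : (m ! : ℝ) ≠ 0 := by positivity
  have hn : (n ! : ℝ) ≠ 0 := by positivity
  simp only [assocStirlingSubset, map_smul, PowerSeries.coeff_mk, smul_eq_mul]
  field_simp

/-- For `x > 0` the equation `y e^y = x` has a unique positive solution. -/
theorem existsUnique_pos_mul_exp_eq {x : ℝ} (hx : 0 < x) :
    ∃! y : ℝ, 0 < y ∧ y * Real.exp y = x := by
  have hcont : ContinuousOn (fun y : ℝ => y * Real.exp y) (Set.Icc 0 x) := by fun_prop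
  have hmem : x ∈ Set.Icc ((0 : ℝ) * Real.exp 0) (x * Real.exp x) :=
    ⟨by simpa using hx.le, by nlinarith [Real.one_le_exp hx.le]⟩
  obtain ⟨y, hy, hyx⟩ := intermediate_value_Icc hx.le hcont hmem
  have hyx' : y * Real.exp y = x := hyx
  have hy0 : 0 < y := by
    rcases hy.1.eq_or_lt with h | h
    · rw [← h, zero_mul] at hyx'
      exact absurd hyx' hx.ne
    · exact h
  have hlt : ∀ a b : ℝ, 0 < a → a < b → a * Real.exp a < b * Real.exp b := fun a b ha hab =>
    mul_lt_mul hab (Real.exp_le_exp.2 hab.le) (Real.exp_pos a) (ha.trans hab).le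
  refine ⟨y, ⟨hy0, hyx'⟩, ?_⟩
  rintro z ⟨hz0, hzx⟩
  rcases lt_trichotomy z y with h | h | h
  · exact absurd (hzx.trans hyx'.symm) (hlt z y hz0 h).ne
  · exact h
  · exact absurd (hyx'.trans hzx.symm) (hlt y z hy0 h).ne

/-- The Lambert function `W` at positive real arguments: `W x` is the unique positive solution `y`
of `y e^y = x`. (At `x ≤ 0` it takes an unspecified value, never used.) -/
noncomputable def lambertW (x : ℝ) : ℝ :=
  Classical.epsilon (fun y : ℝ => 0 < y ∧ y * Real.exp y = x)

theorem lambertW_spec {x : ℝ} (hx : 0 < x) :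
    0 < lambertW x ∧ lambertW x * Real.exp (lambertW x) = x :=
  Classical.epsilon_spec (existsUnique_pos_mul_exp_eq hx).exists

/-!
Substituting `W = L₁ - L₂ + v` into `W e^W = x` gives `1 - e^{-v} + σ v = τ`, or equivalently
`v = (τ + h v) / (1 + σ)` with `h v = e^{-v} - 1 + v`. The proof solves this equation for complex
`τ`, and identifies the series with the Taylor series at `τ = 0` of the solution `v`.

*Existence.* On the closed disc of radius `log 2` we have `|h| ≤ 1 - log 2`, and `h` is
`1`-Lipschitz because `|h'| ≤ e^{|w|} - 1 ≤ 1`. Hence, for `|τ| ≤ (2 + σ) log 2 - 1`, the right-hand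
side is a contraction of that disc (`exists_isFixedPt`). Its fixed point is Lipschitz in `τ`,
therefore holomorphic (`exists_hasDerivAt_inverse`), and the Taylor series converges on the whole
open disc of radius `(2 + σ) log 2 - 1`, which contains `log L / L` for every `L ≥ log 2`
(`abs_log_div_self_lt`).

*Coefficients.* With `E = e^{-v}` and `q = 1 / (σ + E)` one has `v' = q`, `E' = -E q` and
`q' = E q³`, so each derivative of `v` is a polynomial in `E` and `q`. Differentiating once more
reproduces the recurrence `{n+2, p+1} = (p+1) {n+1, p+1} + (n+1) {n, p}` of the 2-associated
Stirling numbers (`assocStirlingSubset_succ_succ`), so that the polynomials are known explicitly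
(`iteratedDeriv_eq_sum_assocStirlingSubset`). At `τ = 0` we have `E = 1` and `q = ζ`. No form of
Lagrange inversion is needed.

The coefficients are real, so `v` is real at real `τ`, and `L₁ - L₂ + v` solves `W e^W = x`.
-/

/-! ### The 2-associated Stirling subset numbers -/

theorem assocStirlingSubset_eq_zero {n p : ℕ} (h : n < 2 * p) : assocStirlingSubset n p = 0 := by
  have hX : (PowerSeries.X : PowerSeries ℝ) ^ 2 ∣
      PowerSeries.exp ℝ - 1 - (PowerSeries.X : PowerSeries ℝ) := by
    rw [PowerSeries.X_pow_dvd_iff]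
    intro m hm
    interval_cases m <;> simp [PowerSeries.coeff_exp, PowerSeries.coeff_one, PowerSeries.coeff_X]
  have hXp := pow_dvd_pow_of_dvd hX p
  rw [← pow_mul, PowerSeries.X_pow_dvd_iff] at hXp
  rw [assocStirlingSubset, hXp n h, mul_zero]

theorem assocStirlingSubset_zero_zero : assocStirlingSubset 0 0 = 1 := by
  simp [assocStirlingSubset]

theorem assocStirlingSubset_succ_zero (n : ℕ) : assocStirlingSubset (n + 1) 0 = 0 := by
  simp [assocStirlingSubset, PowerSeries.coeff_one]

/-- The recurrence of the 2-associated Stirling subset numbers. It expresses that the derivative of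
`(e^z - 1 - z)^(p+1)` is `(p+1) ((e^z - 1 - z)^(p+1) + z (e^z - 1 - z)^p)`. -/
theorem assocStirlingSubset_succ_succ (n p : ℕ) :
    assocStirlingSubset (n + 2) (p + 1) =
      (p + 1) * assocStirlingSubset (n + 1) (p + 1) + (n + 1) * assocStirlingSubset n p := by
  set G : PowerSeries ℝ := PowerSeries.exp ℝ - 1 - PowerSeries.X with hG
  have hGd : PowerSeries.derivative ℝ G = G + PowerSeries.X := by
    have he : PowerSeries.derivative ℝ (PowerSeries.exp ℝ) = PowerSeries.exp ℝ := by
      ext k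
      rw [PowerSeries.coeff_derivative, PowerSeries.coeff_exp, PowerSeries.coeff_exp]
      simp only [Nat.factorial_succ, map_div₀, map_one, map_natCast]
      push_cast
      field_simp
    rw [hG, map_sub, map_sub, he, PowerSeries.derivative_X, PowerSeries.derivative_one]
    ring
  have hd : PowerSeries.derivative ℝ (G ^ (p + 1)) =
      ((p + 1 : ℕ) : ℝ) • (G ^ (p + 1) + PowerSeries.X * G ^ p) := by
    rw [PowerSeries.derivative_pow, hGd, Nat.add_sub_cancel, Nat.cast_smul_eq_nsmul, nsmul_eq_mul]
    ring
  have hc := congrArg (PowerSeries.coeff (n + 1)) hd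
  rw [PowerSeries.coeff_derivative, map_smul, map_add, PowerSeries.coeff_succ_X_mul,
    smul_eq_mul] at hc
  push_cast at hc
  have h1 : ((n + 2) ! : ℝ) = (n + 1 + 1) * ((n + 1) * n !) := by
    rw [Nat.factorial_succ, Nat.factorial_succ]; push_cast; ring
  have h2 : ((n + 1) ! : ℝ) = (n + 1) * n ! := by
    rw [Nat.factorial_succ]; push_cast; ring
  have h3 : ((p + 1) ! : ℝ) = (p + 1) * p ! := by
    rw [Nat.factorial_succ]; push_cast; ring
  simp only [assocStirlingSubset, ← hG, h1, h2, h3]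
  have hp : (p ! : ℝ) ≠ 0 := by positivity
  field_simp
  linear_combination hc

/-- The sign-carrying coefficient of `e^{-pv} / (σ + e^{-v})^(k+1+p)` in the `(k+1)`-st derivative
of the inverse of `v ↦ 1 - e^{-v} + σ v`. -/
noncomputable def inverseDerivCoeff (k p : ℕ) : ℝ :=
  (-1) ^ (p + k) * assocStirlingSubset (p + k) p

theorem inverseDerivCoeff_succ_zero (k : ℕ) : inverseDerivCoeff (k + 1) 0 = 0 := by
  rw [inverseDerivCoeff, ← add_assoc, assocStirlingSubset_succ_zero, mul_zero]

theorem inverseDerivCoeff_self_succ (k : ℕ) : inverseDerivCoeff k (k + 1) = 0 := by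
  rw [inverseDerivCoeff, assocStirlingSubset_eq_zero (by lia), mul_zero]

theorem inverseDerivCoeff_succ_succ (k p : ℕ) :
    inverseDerivCoeff (k + 1) (p + 1) =
      -(p + 1) * inverseDerivCoeff k (p + 1) + (k + 1 + p) * inverseDerivCoeff k p := by
  simp only [inverseDerivCoeff]
  rw [show p + 1 + (k + 1) = p + k + 2 by ring, show p + 1 + k = p + k + 1 by ring,
    assocStirlingSubset_succ_succ]
  push_cast
  ring

/-! ### Derivatives of the inverse function -/

theorem sum_inverseDerivCoeff_succ (k : ℕ) (E q : ℂ) :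
    ∑ p ∈ Finset.range (k + 1), (inverseDerivCoeff k p : ℂ) *
        (-p * E ^ p * q ^ (k + 2 + p) + (k + 1 + p) * E ^ (p + 1) * q ^ (k + 3 + p)) =
      ∑ p ∈ Finset.range (k + 2), (inverseDerivCoeff (k + 1) p : ℂ) * E ^ p * q ^ (k + 2 + p) := by
  have h1 : ∑ p ∈ Finset.range (k + 1),
      (inverseDerivCoeff k p : ℂ) * (-p * E ^ p * q ^ (k + 2 + p)) =
      ∑ p ∈ Finset.range (k + 1), (inverseDerivCoeff k (p + 1) : ℂ) *
        (-(p + 1) * E ^ (p + 1) * q ^ (k + 3 + p)) := by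
    -- The sum may be extended to `p = k + 1`, whose coefficient vanishes, and `p = 0` dropped.
    have h := Finset.sum_range_succ (fun p : ℕ =>
      (inverseDerivCoeff k p : ℂ) * (-p * E ^ p * q ^ (k + 2 + p))) (k + 1)
    rw [Finset.sum_range_succ', inverseDerivCoeff_self_succ] at h
    simp only [Complex.ofReal_zero, zero_mul, Nat.cast_zero, neg_zero, mul_zero, add_zero] at h
    rw [← h]
    refine Finset.sum_congr rfl fun p _ => ?_
    push_cast
    ring
  rw [Finset.sum_range_succ' _ (k + 1), inverseDerivCoeff_succ_zero]
  simp only [mul_add, Finset.sum_add_distrib, Complex.ofReal_zero, zero_mul, add_zero]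
  rw [h1, ← Finset.sum_add_distrib]
  refine Finset.sum_congr rfl fun p _ => ?_
  rw [inverseDerivCoeff_succ_succ]
  push_cast
  ring

/-- All derivatives of a solution of `v' = 1 / (σ + e^{-v})`, as polynomials in `e^{-v}` and
`1 / (σ + e^{-v})`. -/
theorem iteratedDeriv_eq_sum_assocStirlingSubset {v : ℂ → ℂ} {U : Set ℂ} {σ : ℂ} (hU : IsOpen U)
    (hne : ∀ t ∈ U, σ + Complex.exp (-v t) ≠ 0)
    (hv : ∀ t ∈ U, HasDerivAt v (σ + Complex.exp (-v t))⁻¹ t) (k : ℕ) :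
    ∀ t ∈ U, iteratedDeriv (k + 1) v t = ∑ p ∈ Finset.range (k + 1),
      (inverseDerivCoeff k p : ℂ) * Complex.exp (-v t) ^ p *
        (σ + Complex.exp (-v t))⁻¹ ^ (k + 1 + p) := by
  induction k with
  | zero =>
    intro t ht
    simp [(hv t ht).deriv, inverseDerivCoeff, assocStirlingSubset_zero_zero]
  | succ k ih =>
    intro t ht
    rw [iteratedDeriv_succ, Filter.EventuallyEq.deriv_eq
      (Filter.eventually_of_mem (hU.mem_nhds ht) ih), ← sum_inverseDerivCoeff_succ]
    have hE : HasDerivAt (fun t => Complex.exp (-v t))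
        (-Complex.exp (-v t) * (σ + Complex.exp (-v t))⁻¹) t := by
      refine (hv t ht).fun_neg.cexp.congr_deriv ?_
      ring
    have hq : HasDerivAt (fun t => (σ + Complex.exp (-v t))⁻¹)
        (Complex.exp (-v t) * (σ + Complex.exp (-v t))⁻¹ ^ 3) t := by
      refine ((hE.const_add σ).fun_inv (hne t ht)).congr_deriv ?_
      have := hne t ht
      field_simp
    refine (HasDerivAt.fun_sum fun p _ => ?_).deriv
    refine (((hE.fun_pow p).const_mul (inverseDerivCoeff k p : ℂ)).fun_mul
      (hq.fun_pow (k + 1 + p))).congr_deriv ?_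
    generalize (σ + Complex.exp (-v t))⁻¹ = q
    generalize Complex.exp (-v t) = E
    rcases p with _ | p
    · simp only [Nat.add_sub_cancel, add_right_comm k 1]
      push_cast
      ring
    · simp only [Nat.add_sub_cancel, show k + 1 + (p + 1) - 1 = k + 1 + p by lia]
      push_cast
      ring

/-! ### The contraction and its fixed point -/

/-- The function `h w = e^{-w} - 1 + w`, the nonlinear part of `(1 + σ) w - (1 - e^{-w} + σ w)`. -/
noncomputable def expNegRem (w : ℂ) : ℂ := Complex.exp (-w) - 1 + w

theorem norm_expNegRem_le {w : ℂ} (hw : ‖w‖ ≤ Real.log 2) : ‖expNegRem w‖ ≤ 1 - Real.log 2 := by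
  have h := Complex.norm_exp_sub_sum_le_exp_norm_sub_sum (-w) 2
  have h1 : Complex.exp (-w) - ∑ m ∈ Finset.range 2, (-w) ^ m / (m ! : ℂ) = expNegRem w := by
    simp [Finset.sum_range_succ, expNegRem]
    ring
  rw [h1, norm_neg] at h
  simp only [Finset.sum_range_succ, Finset.sum_range_zero, pow_zero, pow_one, Nat.factorial,
    Nat.cast_one, div_one, zero_add, mul_one] at h
  -- `e^r - r` is increasing for `r ≥ 0`: compare `e^{log 2} = e^{‖w‖} e^{log 2 - ‖w‖}`.
  have h2 : Real.exp ‖w‖ * Real.exp (Real.log 2 - ‖w‖) = 2 := by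
    rw [← Real.exp_add, add_sub_cancel, Real.exp_log two_pos]
  have h3 := Real.add_one_le_exp (Real.log 2 - ‖w‖)
  have h4 := Real.one_le_exp (norm_nonneg w)
  nlinarith

theorem norm_one_sub_exp_neg_le {w : ℂ} (hw : ‖w‖ ≤ Real.log 2) :
    ‖1 - Complex.exp (-w)‖ ≤ 1 := by
  have h := Complex.norm_exp_sub_sum_le_exp_norm_sub_sum (-w) 1
  simp only [Finset.sum_range_one, pow_zero, Nat.factorial_zero, Nat.cast_one, div_one,
    norm_neg] at h
  have h2 : Real.exp ‖w‖ ≤ 2 := (Real.le_log_iff_exp_le two_pos).1 hw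
  rw [norm_sub_rev]
  linarith

theorem norm_expNegRem_sub_le {w z : ℂ} (hw : w ∈ Metric.closedBall (0 : ℂ) (Real.log 2))
    (hz : z ∈ Metric.closedBall (0 : ℂ) (Real.log 2)) :
    ‖expNegRem w - expNegRem z‖ ≤ ‖w - z‖ := by
  have hd : ∀ u ∈ Metric.closedBall (0 : ℂ) (Real.log 2),
      HasDerivWithinAt expNegRem (1 - Complex.exp (-u))
        (Metric.closedBall (0 : ℂ) (Real.log 2)) u := by
    intro u _
    refine (((hasDerivAt_neg' u).cexp.sub_const 1).fun_add
      (hasDerivAt_id' u)).hasDerivWithinAt.congr_deriv ?_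
    ring
  have hb : ∀ u ∈ Metric.closedBall (0 : ℂ) (Real.log 2), ‖1 - Complex.exp (-u)‖ ≤ 1 :=
    fun u hu => norm_one_sub_exp_neg_le (mem_closedBall_zero_iff.1 hu)
  simpa using (convex_closedBall (0 : ℂ) (Real.log 2)).norm_image_sub_le_of_norm_hasDerivWithin_le
    hd hb hz hw

theorem exists_isFixedPt {σ : ℝ} (hσ : 0 < σ) {t : ℂ} (ht : ‖t‖ ≤ (2 + σ) * Real.log 2 - 1) :
    ∃ w ∈ Metric.closedBall (0 : ℂ) (Real.log 2), (1 + σ) * w = t + expNegRem w := by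
  have hσ' : (1 + σ : ℂ) ≠ 0 := by exact_mod_cast (by positivity : (1 + σ : ℝ) ≠ 0)
  have hn : ‖(1 + σ : ℂ)‖ = 1 + σ := by
    rw [← Complex.ofReal_one, ← Complex.ofReal_add, Complex.norm_real,
      Real.norm_of_nonneg (by positivity)]
  have hmaps : Set.MapsTo (fun w => (t + expNegRem w) / (1 + σ : ℂ))
      (Metric.closedBall (0 : ℂ) (Real.log 2)) (Metric.closedBall (0 : ℂ) (Real.log 2)) := by
    intro w hw
    rw [mem_closedBall_zero_iff] at hw ⊢
    rw [norm_div, hn, div_le_iff₀ (by positivity)]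
    linarith [norm_add_le t (expNegRem w), norm_expNegRem_le hw]
  have hcontr : ContractingWith (Real.toNNReal (1 + σ)⁻¹) (hmaps.restrict _ _ _) := by
    refine ⟨?_, LipschitzWith.of_dist_le_mul ?_⟩
    · rw [Real.toNNReal_lt_one]
      exact inv_lt_one_of_one_lt₀ (by linarith)
    · rintro ⟨w, hw⟩ ⟨z, hz⟩
      rw [Real.coe_toNNReal _ (by positivity)]
      simp only [Subtype.dist_eq, Set.MapsTo.val_restrict_apply, dist_eq_norm]
      rw [← sub_div, add_sub_add_left_eq_sub, norm_div, hn, div_eq_inv_mul]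
      gcongr
      exact norm_expNegRem_sub_le hw hz
  obtain ⟨w, hw, hfix, -⟩ := hcontr.exists_fixedPoint' Metric.isClosed_closedBall.isComplete hmaps
    (x := 0) (Metric.mem_closedBall_self (Real.log_nonneg one_le_two)) (edist_ne_top _ _)
  refine ⟨w, hw, ?_⟩
  have h : (t + expNegRem w) / (1 + σ : ℂ) = w := hfix
  rw [div_eq_iff hσ'] at h
  rw [h, mul_comm]

/-- A holomorphic inverse `v` of `w ↦ 1 - e^{-w} + σ w` with `v 0 = 0`, on the disc of radius
`(2 + σ) log 2 - 1`. -/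
theorem exists_hasDerivAt_inverse {σ : ℝ} (hσ : 0 < σ) :
    ∃ v : ℂ → ℂ, v 0 = 0 ∧ ∀ t ∈ Metric.ball (0 : ℂ) ((2 + σ) * Real.log 2 - 1),
      1 - Complex.exp (-v t) + σ * v t = t ∧ σ + Complex.exp (-v t) ≠ 0 ∧
        HasDerivAt v (σ + Complex.exp (-v t))⁻¹ t := by
  set B := Metric.ball (0 : ℂ) ((2 + σ) * Real.log 2 - 1) with hB
  have hex : ∀ t : ℂ, ∃ w : ℂ, t ∈ B →
      w ∈ Metric.closedBall (0 : ℂ) (Real.log 2) ∧ (1 + σ) * w = t + expNegRem w := by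
    intro t
    by_cases ht : t ∈ B
    · obtain ⟨w, hw, h⟩ := exists_isFixedPt hσ (mem_ball_zero_iff.1 ht).le
      exact ⟨w, fun _ => ⟨hw, h⟩⟩
    · exact ⟨0, fun h => absurd h ht⟩
  choose v hv using hex
  have hn : ‖(1 + σ : ℂ)‖ = 1 + σ := by
    rw [← Complex.ofReal_one, ← Complex.ofReal_add, Complex.norm_real,
      Real.norm_of_nonneg (by positivity)]
  have hlip : ∀ s ∈ B, ∀ t ∈ B, ‖v s - v t‖ ≤ σ⁻¹ * ‖s - t‖ := by
    intro s hs t ht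
    have h1 : (1 + σ : ℂ) * (v s - v t) = (s - t) + (expNegRem (v s) - expNegRem (v t)) := by
      linear_combination (hv s hs).2 - (hv t ht).2
    have h2 := congrArg norm h1
    rw [norm_mul, hn] at h2
    have h3 := norm_add_le (s - t) (expNegRem (v s) - expNegRem (v t))
    have h4 := norm_expNegRem_sub_le (hv s hs).1 (hv t ht).1
    rw [le_inv_mul_iff₀ hσ]
    linarith
  have heq : ∀ t ∈ B, 1 - Complex.exp (-v t) + σ * v t = t := by
    intro t ht
    have h := (hv t ht).2
    rw [expNegRem] at h
    linear_combination h
  have h0 : (0 : ℂ) ∈ B := by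
    have := Real.log_two_gt_d9
    refine Metric.mem_ball_self ?_
    nlinarith
  have hv0 : v 0 = 0 := by
    have h1 := (hv 0 h0).2
    have h2 := congrArg norm h1
    rw [norm_mul, hn, zero_add] at h2
    have h3 := norm_expNegRem_sub_le (hv 0 h0).1
      (Metric.mem_closedBall_self (Real.log_nonneg one_le_two))
    have h4 : expNegRem 0 = 0 := by simp [expNegRem]
    rw [h4, sub_zero, sub_zero] at h3
    have h5 := norm_nonneg (v 0)
    exact norm_le_zero_iff.1 (by nlinarith)
  refine ⟨v, hv0, fun t ht => ⟨heq t ht, ?_⟩⟩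
  have hnhds : B ∈ nhds t := Metric.isOpen_ball.mem_nhds ht
  have hcont : ContinuousAt v t := by
    rw [ContinuousAt, tendsto_iff_norm_sub_tendsto_zero]
    refine squeeze_zero' (Filter.Eventually.of_forall fun _ => norm_nonneg _)
      (Filter.eventually_of_mem hnhds fun s hs => hlip s hs t ht) ?_
    have : ContinuousAt (fun s => σ⁻¹ * ‖s - t‖) t := by fun_prop
    simpa [ContinuousAt] using this
  have hg : HasDerivAt (fun w : ℂ => 1 - Complex.exp (-w) + σ * w)
      (σ + Complex.exp (-v t)) (v t) := by
    refine (((hasDerivAt_neg' (v t)).cexp.const_sub 1).fun_add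
      ((hasDerivAt_id' (v t)).const_mul (σ : ℂ))).congr_deriv ?_
    ring
  -- If `e^{-v} = -σ`, then `|1 - e^{-v}| = 1 + σ > 1`.
  have hne : σ + Complex.exp (-v t) ≠ 0 := by
    intro h
    have h1 := norm_one_sub_exp_neg_le (mem_closedBall_zero_iff.1 (hv t ht).1)
    rw [show 1 - Complex.exp (-v t) = 1 + σ by linear_combination -h, hn] at h1
    linarith
  exact ⟨hne, HasDerivAt.of_local_left_inverse hcont hg hne
    (Filter.eventually_of_mem hnhds heq)⟩

/-! ### Size of the argument -/

theorem abs_log_div_self_lt {L : ℝ} (hL : Real.log 2 ≤ L) :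
    |Real.log L / L| < (2 + 1 / L) * Real.log 2 - 1 := by
  have h2 := Real.log_two_gt_d9
  have hL0 : 0 < L := by linarith
  rcases le_or_gt 1 L with h1 | h1
  · rw [abs_of_nonneg (div_nonneg (Real.log_nonneg h1) hL0.le)]
    -- The maximum of `log L / L` is `1 / e`, attained at `L = e`.
    have he := Real.exp_one_gt_d9
    have hlog := Real.log_le_sub_one_of_pos (div_pos hL0 (Real.exp_pos 1))
    rw [Real.log_div hL0.ne' (Real.exp_pos 1).ne', Real.log_exp] at hlog
    have h3 : Real.log L / L ≤ (Real.exp 1)⁻¹ := by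
      rw [div_le_iff₀ hL0, inv_mul_eq_div]
      linarith
    have h4 : (Real.exp 1)⁻¹ < 0.3679 := by
      rw [inv_lt_comm₀ (Real.exp_pos 1) (by norm_num)]
      exact lt_trans (by norm_num) he
    have h5 : 0 ≤ 1 / L * Real.log 2 := by positivity
    linarith
  · rw [abs_of_nonpos (div_nonpos_of_nonpos_of_nonneg (Real.log_nonpos hL0.le h1.le) hL0.le)]
    have h3 : -Real.log 2 ≤ Real.log L := by
      rw [← Real.log_inv]
      exact Real.log_le_log (by norm_num) (by norm_num; linarith)
    have h4 : -(Real.log L / L) ≤ 1 / L * Real.log 2 := by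
      rw [← neg_div, one_div_mul_eq_div]
      gcongr
      linarith
    linarith

/-! ### The series for the Lambert function -/

/-- For real `τ` in the disc of convergence, the Taylor series at `0` of the inverse of
`w ↦ 1 - e^{-w} + σ w` converges to a real preimage of `τ`. -/
theorem exists_hasSum_inverse {σ τ : ℝ} (hσ : 0 < σ) (hτ : |τ| < (2 + σ) * Real.log 2 - 1) :
    ∃ y : ℝ, 1 - Real.exp (-y) + σ * y = τ ∧
      HasSum (fun k : ℕ => τ ^ (k + 1) / ((k + 1) ! : ℝ) *
        ∑ p ∈ Finset.range (k + 1), inverseDerivCoeff k p * (1 / (1 + σ)) ^ (k + 1 + p)) y := by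
  obtain ⟨v, hv0, hv⟩ := exists_hasDerivAt_inverse hσ
  set B := Metric.ball (0 : ℂ) ((2 + σ) * Real.log 2 - 1) with hB
  have hτB : (τ : ℂ) ∈ B := by simpa [hB] using hτ
  have h0B : (0 : ℂ) ∈ B := Metric.mem_ball_self ((abs_nonneg τ).trans_lt hτ)
  have hsum := Complex.hasSum_taylorSeries_on_ball
    (fun t ht => (hv t ht).2.2.differentiableAt.differentiableWithinAt) hτB
  rw [← hasSum_nat_add_iff' 1] at hsum
  simp only [Finset.sum_range_one, iteratedDeriv_zero, hv0, smul_zero, sub_zero] at hsum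
  have hterm : ∀ k : ℕ, ((k + 1) ! : ℂ)⁻¹ • (τ : ℂ) ^ (k + 1) • iteratedDeriv (k + 1) v 0 =
      ((τ ^ (k + 1) / ((k + 1) ! : ℝ) * ∑ p ∈ Finset.range (k + 1),
        inverseDerivCoeff k p * (1 / (1 + σ)) ^ (k + 1 + p) : ℝ) : ℂ) := by
    intro k
    rw [iteratedDeriv_eq_sum_assocStirlingSubset Metric.isOpen_ball (fun t ht => (hv t ht).2.1)
      (fun t ht => (hv t ht).2.2) k 0 h0B, hv0]
    push_cast
    simp only [neg_zero, Complex.exp_zero, one_pow, mul_one, smul_eq_mul, one_div, add_comm (σ : ℂ)]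
    ring
  simp only [hterm] at hsum
  -- A sum of real terms is real.
  have him : (v τ).im = 0 :=
    (Complex.hasSum_im hsum).unique (by simpa only [Complex.ofReal_im] using hasSum_zero)
  have hre : ((v τ).re : ℂ) = v τ := Complex.ext rfl (by simp [him])
  refine ⟨(v τ).re, ?_, by simpa only [Complex.ofReal_re] using Complex.hasSum_re hsum⟩
  have h := (hv τ hτB).1
  rw [← hre] at h
  exact_mod_cast h

theorem lambertW_eq {x y : ℝ} (hx : 0 < x) (hy : y * Real.exp y = x) : lambertW x = y :=
  (existsUnique_pos_mul_exp_eq hx).unique (lambertW_spec hx)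
    ⟨pos_of_mul_pos_left (hy ▸ hx) (Real.exp_pos y).le, hy⟩

theorem lambertW_eq_log_sub_log_add {x y : ℝ} (hx : 1 < x)
    (hy : 1 - Real.exp (-y) + 1 / Real.log x * y = Real.log (Real.log x) / Real.log x) :
    lambertW x = Real.log x - Real.log (Real.log x) + y := by
  have hL : 0 < Real.log x := Real.log_pos hx
  apply lambertW_eq (one_pos.trans hx)
  rw [Real.exp_add, Real.exp_sub, Real.exp_log (one_pos.trans hx), Real.exp_log hL]
  have h : Real.log x - Real.log (Real.log x) + y = Real.log x * Real.exp (-y) := by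
    field_simp at hy
    linarith
  have he : Real.exp (-y) * Real.exp y = 1 := by rw [← Real.exp_add, neg_add_cancel, Real.exp_zero]
  have hLx : Real.log x * (x / Real.log x) = x := mul_div_cancel₀ x hL.ne'
  rw [h]
  linear_combination x * he + Real.exp (-y) * Real.exp y * hLx

theorem theorem3 (x : ℝ) (hx : 2 ≤ x) (L₁ L₂ σ τ ζ : ℝ)
    (hL₁ : L₁ = Real.log x) (hL₂ : L₂ = Real.log (Real.log x))
    (hσ : σ = 1 / L₁) (hτ : τ = L₂ / L₁) (hζ : ζ = 1 / (1 + σ)) :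
    Summable (fun m : ℕ+ =>
      τ ^ (m : ℕ) / ((m : ℕ) ! : ℝ) *
        ∑ p ∈ Finset.range (m : ℕ),
          (-1) ^ (p + (m : ℕ) - 1) * ζ ^ (p + (m : ℕ)) *
            assocStirlingSubset (p + (m : ℕ) - 1) p) ∧
    lambertW x = L₁ - L₂ +
      ∑' m : ℕ+, τ ^ (m : ℕ) / ((m : ℕ) ! : ℝ) *
        ∑ p ∈ Finset.range (m : ℕ),
          (-1) ^ (p + (m : ℕ) - 1) * ζ ^ (p + (m : ℕ)) *
            assocStirlingSubset (p + (m : ℕ) - 1) p := by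

  have hlog : Real.log 2 ≤ L₁ := hL₁ ▸ Real.log_le_log two_pos hx
  have hL₁0 : 0 < L₁ := (Real.log_pos one_lt_two).trans_le hlog
  have hσ0 : 0 < σ := by rw [hσ]; positivity
  have hτlt : |τ| < (2 + σ) * Real.log 2 - 1 := by
    rw [hτ, hσ, hL₂, ← hL₁]
    exact abs_log_div_self_lt hlog
  obtain ⟨y, hy, hsum⟩ := exists_hasSum_inverse hσ0 hτlt
  have hsum' : HasSum (fun m : ℕ+ => τ ^ (m : ℕ) / ((m : ℕ) ! : ℝ) *
        ∑ p ∈ Finset.range (m : ℕ), (-1) ^ (p + (m : ℕ) - 1) * ζ ^ (p + (m : ℕ)) *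
          assocStirlingSubset (p + (m : ℕ) - 1) p) y := by
    rw [← Equiv.pnatEquivNat.symm.hasSum_iff]
    convert hsum using 2 with k
    simp only [Function.comp_apply, Equiv.pnatEquivNat_symm_apply, Nat.succPNat_coe,
      Nat.succ_eq_add_one]
    congr 1
    refine Finset.sum_congr rfl fun p _ => ?_
    rw [inverseDerivCoeff, ← hζ, show p + (k + 1) - 1 = p + k by lia, add_comm p (k + 1)]
    ring
  refine ⟨hsum'.summable, ?_⟩
  rw [hsum'.tsum_eq, hL₂, hL₁]
  apply lambertW_eq_log_sub_log_add (by linarith)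
  rw [← hL₁, ← hσ, hy, hτ, hL₂, ← hL₁]
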